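/- A set $C\subset\mathbb{R}^n$ has an $\mathcal{S}_+^k$-lift if $C=\pi(\mathcal{S}_+^k\cap L)$ for some affine subspace $L$ of the space of real symmetric $k\times k$ matrices and some linear map $\pi$ from that space to $\mathbb{R}^n$, where $\mathcal{S}_+^k$ is the cone of real symmetric positive semidefinite $k\times k$ matrices. The psd rank of $C$ is the smallest positive integer $k$ for which $C$ has an $\mathcal{S}_+^k$-lift ($\infty$ if there is none). A full-dimensional polytope in $\mathbb{R}^n$ (the convex hull of finitely many points, with nonempty interior) is called psd-minimal if its psd rank equals $n+1$. A polygon is a full-dimensional polytope in $\mathbb{R}^2$. **Proposition.** The psd-minimal polygons are exactly the triangles and the quadrilaterals: a polygon $P\subset\mathbb{R}^2$ has psd rank $3$ if and only if it has exactly three or exactly four vertices. -/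

import Mathlib

/-- `ℝⁿ` with its Euclidean structure. -/
abbrev Rn (n : ℕ) : Type := EuclideanSpace ℝ (Fin n)

/-- The cone `𝒮₊ᵏ` of real symmetric positive semidefinite `k × k` matrices
(for real matrices, `Matrix.PosSemidef` includes symmetry). -/
def psdCone (k : ℕ) : Set (Matrix (Fin k) (Fin k) ℝ) :=
  {A | A.PosSemidef}

/-- `C ⊆ ℝⁿ` has an `𝒮₊ᵏ`-lift: `C = π(𝒮₊ᵏ ∩ L)` for an affine space `L` and a linear map `π`.
Here `L` and `π` live on the space of all `k × k` matrices; this is the same as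
taking them on the subspace of symmetric matrices, since only `𝒮₊ᵏ ∩ L` matters and
every linear map on the symmetric matrices extends to all matrices. -/
def HasPsdLift {n : ℕ} (k : ℕ) (C : Set (Rn n)) : Prop :=
  ∃ (L : AffineSubspace ℝ (Matrix (Fin k) (Fin k) ℝ))
    (π : Matrix (Fin k) (Fin k) ℝ →ₗ[ℝ] Rn n),
    C = π '' (psdCone k ∩ (L : Set (Matrix (Fin k) (Fin k) ℝ)))

/-- The psd rank of `C`: the smallest positive integer `k` such that `C` has an `𝒮₊ᵏ`-lift,
and `⊤` (infinity) if there is no such `k`. -/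
noncomputable def psdRank {n : ℕ} (C : Set (Rn n)) : ℕ∞ :=
  ⨅ (k : ℕ) (_ : 0 < k ∧ HasPsdLift k C), (k : ℕ∞)

/-- A full-dimensional (convex) polytope in `ℝⁿ`: the convex hull of finitely many points,
with nonempty interior. -/
def IsFullDimPolytope {n : ℕ} (P : Set (Rn n)) : Prop :=
  (∃ V : Finset (Rn n), P = convexHull ℝ (V : Set (Rn n))) ∧ (interior P).Nonempty

/-- A psd-minimal polytope: a full-dimensional polytope in `ℝⁿ` with psd rank exactly `n + 1`. -/
def IsPsdMinimal {n : ℕ} (P : Set (Rn n)) : Prop :=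
  IsFullDimPolytope P ∧ psdRank P = (n : ℕ∞) + 1

/-- A (convex) polygon: a full-dimensional polytope in the plane. -/
def IsPolygon (P : Set (Rn 2)) : Prop :=
  IsFullDimPolytope P

/-- An `m`-gon: a polygon with exactly `m` vertices (extreme points). -/
def IsNGon (m : ℕ) (P : Set (Rn 2)) : Prop :=
  IsPolygon P ∧ (P.extremePoints ℝ).encard = (m : ℕ∞)

/-- A triangle is a 3-gon. -/
def IsTriangle (P : Set (Rn 2)) : Prop :=
  IsNGon 3 P

/-- A (convex) quadrilateral is a 4-gon. -/
def IsQuadrilateral (P : Set (Rn 2)) : Prop :=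
  IsNGon 4 P

/-! Let `P = π (psdCone k ∩ L)` be bounded. If `ker X ⊆ ker Y` for points `X`, `Y` of the
spectrahedron, the segment from `Y` to `X` extends beyond `X` (`exists_prolong`). A vertex or an
edge forbids such an extension, so lifts `A`, `B`, `C` of a vertex, a neighbour and a point off
their edge satisfy `ker (A + B + C) < ker (A + B) < ker A < ⊤` (`finrank_ker_chain`). Hence `k ≥ 3`.

If `k = 3` the chain is tight: vertices lift to rank-one matrices `u uᵀ`, and `L` contains a
positive definite matrix. Conic duality (`exists_dual_psd`) then represents the slack of an edge at
the vertices by a psd form in `u`. That form vanishes at the two independent vectors over the ends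
of the edge, so it has rank at most one, and the slack is a square `(u ⬝ᵥ w) ^ 2`
(`exists_sqrt_slack`). So some entrywise square root of the slack matrix has rank at most `3`.

With at least five vertices, take consecutive ones `v 0, …, v 4`. The root matrix of the first four
against the four edges along them has determinant zero, which reads `X = Y + Z`. The Plücker
relation between the areas reads `X² = Y² + Z²`. Hence `Y * Z = 0`, although no factor vanishes
(`no_sqrt_slack`).

Conversely, the diagonal of a trace-one psd matrix parametrises a triangle, and a quadrilateral is a
projective image of the unit square, which is cut out by `x² ≤ x`, `y² ≤ y`
(`hasPsdLift_three_of_diagonals`). -/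

/-! ### Positive semidefinite matrices: kernels, domination, rank one -/

open Matrix in
theorem psd_iff {k : ℕ} {A : Matrix (Fin k) (Fin k) ℝ} :
    A.PosSemidef ↔ Aᵀ = A ∧ ∀ x : Fin k → ℝ, 0 ≤ x ⬝ᵥ A *ᵥ x := by
  rw [Matrix.posSemidef_iff_dotProduct_mulVec]
  simp [Matrix.IsHermitian, Matrix.conjTranspose_eq_transpose_of_trivial]

open Matrix in
open scoped MatrixOrder in
theorem exists_transpose_mul_self {k : ℕ} {A : Matrix (Fin k) (Fin k) ℝ} (hA : A.PosSemidef) :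
    ∃ C : Matrix (Fin k) (Fin k) ℝ, A = Cᵀ * C := by
  obtain ⟨C, hC⟩ := CStarAlgebra.nonneg_iff_eq_star_mul_self.mp hA.nonneg
  exact ⟨C, by simpa [Matrix.star_eq_conjTranspose,
    Matrix.conjTranspose_eq_transpose_of_trivial] using hC⟩

open Matrix in
theorem quad_transpose_mul_self {k : ℕ} (C : Matrix (Fin k) (Fin k) ℝ) (x : Fin k → ℝ) :
    x ⬝ᵥ (Cᵀ * C) *ᵥ x = ∑ i, (C *ᵥ x) i ^ 2 := by
  rw [← Matrix.mulVec_mulVec, Matrix.dotProduct_mulVec, Matrix.vecMul_transpose]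
  simp [dotProduct, sq]

open Matrix in
theorem psd_mulVec_eq_zero_iff {k : ℕ} {A : Matrix (Fin k) (Fin k) ℝ} (hA : A.PosSemidef)
    (x : Fin k → ℝ) : x ⬝ᵥ A *ᵥ x = 0 ↔ A *ᵥ x = 0 := by
  simpa using hA.dotProduct_mulVec_zero_iff x

open Matrix in
/-- A positive semidefinite form whose kernel contains that of `X` is dominated by a multiple
of `X`. -/
theorem psd_le_smul_of_ker_le {k : ℕ} {X Y : Matrix (Fin k) (Fin k) ℝ} (hX : X.PosSemidef)
    (hY : Y.PosSemidef) (h : ∀ x : Fin k → ℝ, X *ᵥ x = 0 → Y *ᵥ x = 0) :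
    ∃ c : ℝ, 0 < c ∧ ∀ x : Fin k → ℝ, x ⬝ᵥ Y *ᵥ x ≤ c * (x ⬝ᵥ X *ᵥ x) := by
  obtain ⟨C, rfl⟩ := exists_transpose_mul_self hX
  obtain ⟨E, rfl⟩ := exists_transpose_mul_self hY
  -- The common kernel of the rows of `C` is `ker X`, which each row of `E` kills; so every row of
  -- `E` is a combination of rows of `C`, and Cauchy–Schwarz gives the bound.
  have key : ∀ j, ∃ d : Fin k → ℝ, ∀ x, (E *ᵥ x) j = ∑ i, d i * (C *ᵥ x) i := by
    intro j
    have hmem := mem_span_of_iInf_ker_le_ker (𝕜 := ℝ)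
      (L := fun i => (LinearMap.proj i).comp C.mulVecLin)
      (K := (LinearMap.proj j).comp E.mulVecLin) (by
        intro x hx
        simp only [Submodule.mem_iInf, LinearMap.mem_ker, LinearMap.comp_apply,
          LinearMap.proj_apply, Matrix.mulVecLin_apply] at hx ⊢
        have hC : C *ᵥ x = 0 := funext hx
        have h1 : (Cᵀ * C) *ᵥ x = 0 := by rw [← Matrix.mulVec_mulVec, hC, Matrix.mulVec_zero]
        have h2 := (psd_mulVec_eq_zero_iff hY x).mpr (h x h1)
        rw [quad_transpose_mul_self, Finset.sum_eq_zero_iff_of_nonneg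
          (fun i _ => sq_nonneg _)] at h2
        simpa using h2 j (Finset.mem_univ j))
    obtain ⟨d, hd⟩ := (Submodule.mem_span_range_iff_exists_fun ℝ).1 hmem
    refine ⟨d, fun x => ?_⟩
    have := LinearMap.congr_fun hd x
    simpa using this.symm
  choose D hD using key
  refine ⟨(∑ j, ∑ i, D j i ^ 2) + 1, by positivity, fun x => ?_⟩
  rw [quad_transpose_mul_self, quad_transpose_mul_self]
  have h1 : ∑ j, (E *ᵥ x) j ^ 2 ≤ ∑ j, (∑ i, D j i ^ 2) * ∑ i, (C *ᵥ x) i ^ 2 := by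
    refine Finset.sum_le_sum fun j _ => ?_
    rw [hD]
    exact Finset.sum_mul_sq_le_sq_mul_sq _ _ _
  rw [← Finset.sum_mul] at h1
  have h2 : 0 ≤ ∑ i, (C *ᵥ x) i ^ 2 := by positivity
  linarith

open Matrix in
theorem psd_add_mulVec_eq_zero_iff {k : ℕ} {A B : Matrix (Fin k) (Fin k) ℝ} (hA : A.PosSemidef)
    (hB : B.PosSemidef) (x : Fin k → ℝ) :
    (A + B) *ᵥ x = 0 ↔ A *ᵥ x = 0 ∧ B *ᵥ x = 0 := by
  constructor
  · intro h
    have h0 := (psd_mulVec_eq_zero_iff (hA.add hB) x).mpr h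
    rw [Matrix.add_mulVec, dotProduct_add] at h0
    have h1 := (psd_iff.mp hA).2 x
    have h2 := (psd_iff.mp hB).2 x
    exact ⟨(psd_mulVec_eq_zero_iff hA x).mp (by linarith),
      (psd_mulVec_eq_zero_iff hB x).mp (by linarith)⟩
  · rintro ⟨h1, h2⟩
    rw [Matrix.add_mulVec, h1, h2, add_zero]

open Matrix in
/-- A positive semidefinite matrix whose kernel has codimension at most one is `u uᵀ`. -/
theorem exists_eq_vecMulVec {k : ℕ} {A : Matrix (Fin k) (Fin k) ℝ} (hA : A.PosSemidef)
    (hk : k ≤ Module.finrank ℝ (LinearMap.ker A.mulVecLin) + 1) :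
    ∃ u : Fin k → ℝ, A = vecMulVec u u := by
  obtain ⟨C, rfl⟩ := exists_transpose_mul_self hA
  have hker : LinearMap.ker (Cᵀ * C).mulVecLin = LinearMap.ker C.mulVecLin := by
    have := ker_mulVecLin_conjTranspose_mul_self C
    rwa [Matrix.conjTranspose_eq_transpose_of_trivial] at this
  rw [hker] at hk
  have hr := LinearMap.finrank_range_add_finrank_ker C.mulVecLin
  rw [Module.finrank_fin_fun] at hr
  obtain ⟨v, hv⟩ := finrank_le_one_iff.mp
    (show Module.finrank ℝ (LinearMap.range C.mulVecLin) ≤ 1 by omega)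
  have hcol : ∀ j, ∃ c : ℝ, ∀ i, C i j = c * (v : Fin k → ℝ) i := by
    intro j
    obtain ⟨c, hc⟩ := hv ⟨C.mulVecLin (Pi.single j 1), LinearMap.mem_range_self _ _⟩
    refine ⟨c, fun i => ?_⟩
    have := congrFun (congrArg Subtype.val hc) i
    simpa using this.symm
  choose c hc using hcol
  set s : ℝ := ∑ i, (v : Fin k → ℝ) i ^ 2 with hs
  have hs0 : 0 ≤ s := by positivity
  -- Here `C = v cᵀ`, so `Cᵀ * C = ‖v‖² c cᵀ`.
  refine ⟨fun j => Real.sqrt s * c j, ?_⟩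
  ext i j
  rw [Matrix.mul_apply, vecMulVec_apply]
  have : Real.sqrt s * c i * (Real.sqrt s * c j) = s * (c i * c j) := by
    ring_nf; rw [Real.sq_sqrt hs0]; ring
  rw [this, hs, Finset.sum_mul]
  refine Finset.sum_congr rfl fun l _ => ?_
  rw [Matrix.transpose_apply, hc, hc]; ring

open Matrix in
theorem vecMulVec_mulVec_eq {k : ℕ} (u x : Fin k → ℝ) :
    vecMulVec u u *ᵥ x = (u ⬝ᵥ x) • u := by
  ext i
  simp only [Matrix.mulVec, dotProduct, vecMulVec_apply, Pi.smul_apply, smul_eq_mul,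
    Finset.sum_mul]
  exact Finset.sum_congr rfl fun j _ => by ring

open Matrix in
theorem quad_vecMulVec {k : ℕ} (u x : Fin k → ℝ) :
    x ⬝ᵥ vecMulVec u u *ᵥ x = (u ⬝ᵥ x) ^ 2 := by
  rw [vecMulVec_mulVec_eq, dotProduct_smul, dotProduct_comm x u, smul_eq_mul, sq]

open Matrix in
theorem psd_vecMulVec {k : ℕ} (u : Fin k → ℝ) : (vecMulVec u u).PosSemidef := by
  rw [psd_iff]
  refine ⟨?_, fun x => by rw [quad_vecMulVec]; positivity⟩
  ext i j
  simp [vecMulVec_apply, mul_comm]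

open Matrix in
theorem exists_neg_quad_le {k : ℕ} (Y : Matrix (Fin k) (Fin k) ℝ) :
    ∃ N : ℝ, 0 ≤ N ∧ ∀ x : Fin k → ℝ, -(x ⬝ᵥ Y *ᵥ x) ≤ N * (x ⬝ᵥ x) := by
  refine ⟨∑ i, ∑ j, |Y i j|, by positivity, fun x => ?_⟩
  have hx : ∀ i, x i ^ 2 ≤ x ⬝ᵥ x := by
    intro i
    have := Finset.single_le_sum (f := fun i => x i * x i) (fun i _ => mul_self_nonneg _)
      (Finset.mem_univ i)
    simpa [dotProduct, sq] using this
  have hq : -(x ⬝ᵥ Y *ᵥ x) = ∑ i, ∑ j, -(x i * (Y i j * x j)) := by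
    simp only [dotProduct, mulVec, Finset.mul_sum, Finset.sum_neg_distrib]
  rw [hq, Finset.sum_mul]
  refine Finset.sum_le_sum fun i _ => ?_
  rw [Finset.sum_mul]
  refine Finset.sum_le_sum fun j _ => ?_
  have h1 : -(x i * (Y i j * x j)) ≤ |Y i j| * (|x i| * |x j|) := by
    refine (neg_le_abs _).trans (le_of_eq ?_)
    rw [abs_mul, abs_mul]; ring
  have h2 : |x i| * |x j| ≤ x ⬝ᵥ x := by
    have := two_mul_le_add_sq (|x i|) (|x j|)
    rw [sq_abs, sq_abs] at this
    linarith [hx i, hx j]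
  have h3 := mul_le_mul_of_nonneg_left h2 (abs_nonneg (Y i j))
  exact h1.trans h3

/-! ### Prolonging segments and recession directions in a lift -/

open Matrix in
/-- If `X`, `Y` are points of a spectrahedron and `ker X ⊆ ker Y`, then the segment from `Y` to `X`
can be prolonged beyond `X`. -/
theorem exists_prolong {n k : ℕ} {P : Set (Rn n)}
    {L : AffineSubspace ℝ (Matrix (Fin k) (Fin k) ℝ)} {π : Matrix (Fin k) (Fin k) ℝ →ₗ[ℝ] Rn n}
    (hP : P = π '' (psdCone k ∩ (L : Set (Matrix (Fin k) (Fin k) ℝ))))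
    {X Y : Matrix (Fin k) (Fin k) ℝ} (hX : X.PosSemidef) (hY : Y.PosSemidef) (hXL : X ∈ L)
    (hYL : Y ∈ L) (h : ∀ x : Fin k → ℝ, X *ᵥ x = 0 → Y *ᵥ x = 0) :
    ∃ ε : ℝ, 0 < ε ∧ π X + ε • (π X - π Y) ∈ P := by
  obtain ⟨c, hc, hle⟩ := psd_le_smul_of_ker_le hX hY h
  -- `X + ε (X - Y)` is psd as soon as `ε Y ≤ X` as forms, whence `ε = 1 / c`.
  refine ⟨1 / c, by positivity, ?_⟩
  rw [hP]
  refine ⟨X + (1 / c) • (X - Y), ⟨?_, ?_⟩, by simp⟩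
  · refine psd_iff.mpr ?_
    rw [psd_iff] at hX hY
    refine ⟨by simp [hX.1, hY.1], fun x => ?_⟩
    rw [Matrix.add_mulVec, Matrix.smul_mulVec, Matrix.sub_mulVec, dotProduct_add,
      dotProduct_smul, dotProduct_sub, smul_eq_mul]
    have h1 := hX.2 x
    have h2 : 1 / c * (x ⬝ᵥ Y *ᵥ x) ≤ x ⬝ᵥ X *ᵥ x := by
      rw [one_div, inv_mul_le_iff₀ hc]; exact hle x
    have h3 : 0 ≤ 1 / c * (x ⬝ᵥ X *ᵥ x) := by positivity
    rw [mul_sub]; linarith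
  · have := AffineSubspace.vadd_mem_of_mem_direction
      (L.direction.smul_mem (1 / c) (AffineSubspace.vsub_mem_direction hXL hYL)) hXL
    simpa [add_comm] using this

/-- A positive semidefinite recession direction of a lift of a bounded set is killed by the
projection. -/
theorem map_eq_zero_of_recession {n k : ℕ} {P : Set (Rn n)}
    {L : AffineSubspace ℝ (Matrix (Fin k) (Fin k) ℝ)} {π : Matrix (Fin k) (Fin k) ℝ →ₗ[ℝ] Rn n}
    (hP : P = π '' (psdCone k ∩ (L : Set (Matrix (Fin k) (Fin k) ℝ))))
    (hb : Bornology.IsBounded P) {A D : Matrix (Fin k) (Fin k) ℝ} (hA : A.PosSemidef)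
    (hAL : A ∈ L) (hD : D.PosSemidef) (hDL : D ∈ L.direction) : π D = 0 := by
  obtain ⟨R, hR⟩ := hb.exists_norm_le
  by_contra hne
  have hpos : 0 < ‖π D‖ := norm_pos_iff.mpr hne
  have hmem : ∀ t : ℝ, 0 ≤ t → π A + t • π D ∈ P := by
    intro t ht
    rw [hP]
    refine ⟨A + t • D, ⟨hA.add (hD.smul ht), ?_⟩, by simp⟩
    have := AffineSubspace.vadd_mem_of_mem_direction (L.direction.smul_mem t hDL) hAL
    simpa [add_comm] using this
  have h0 := hR _ (hmem 0 le_rfl)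
  rw [zero_smul, add_zero] at h0
  have hR0 : 0 ≤ R := (norm_nonneg _).trans h0
  have h1 := hR _ (hmem ((2 * R + 1) / ‖π D‖) (by positivity))
  have h2 : ‖((2 * R + 1) / ‖π D‖) • π D‖ = 2 * R + 1 := by
    rw [norm_smul, Real.norm_of_nonneg (by positivity)]; field_simp
  have h3 := norm_sub_le (π A + ((2 * R + 1) / ‖π D‖) • π D) (π A)
  rw [add_sub_cancel_left, h2] at h3
  linarith

/-! ### Conic duality by Riesz extension -/

/-- The cone of pairs `(X, t)` for which the quadratic form of `X` is nonnegative. -/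
def quadCone (k : ℕ) : PointedCone ℝ (Matrix (Fin k) (Fin k) ℝ × ℝ) where
  carrier := {Z | ∀ x : Fin k → ℝ, 0 ≤ dotProduct x (Matrix.mulVec Z.1 x)}
  add_mem' := by
    intro a b ha hb x
    have := add_nonneg (ha x) (hb x)
    simpa [Matrix.add_mulVec] using this
  zero_mem' := by intro x; simp
  smul_mem' := by
    intro c a ha x
    have := mul_nonneg c.2 (ha x)
    have h2 : (c • a).1 = (c : ℝ) • a.1 := rfl
    rw [h2, Matrix.smul_mulVec, dotProduct_smul]
    exact this

/-- The homogenization of the symmetric part of the affine space through `A` with direction `U`. -/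
def homogenization {k : ℕ} (U : Submodule ℝ (Matrix (Fin k) (Fin k) ℝ))
    (A : Matrix (Fin k) (Fin k) ℝ) : Submodule ℝ (Matrix (Fin k) (Fin k) ℝ × ℝ) where
  carrier := {Z | Z.1.transpose = Z.1 ∧ Z.1 - Z.2 • A ∈ U}
  add_mem' := by
    rintro a b ⟨ha, ha'⟩ ⟨hb, hb'⟩
    refine ⟨by simp [ha, hb], ?_⟩
    have := U.add_mem ha' hb'
    convert this using 1
    simp only [Prod.fst_add, Prod.snd_add, add_smul]; abel
  zero_mem' := by simp
  smul_mem' := by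
    rintro c a ⟨ha, ha'⟩
    refine ⟨by simp [ha], ?_⟩
    have := U.smul_mem c ha'
    convert this using 1
    simp only [Prod.smul_fst, Prod.smul_snd, smul_sub, smul_smul, smul_eq_mul]

open Matrix in
/-- Conic duality for a lift with a Slater point: a valid affine inequality on the bounded set `P`
is given by a positive semidefinite matrix on the rank-one points of the lift. -/
theorem exists_dual_psd {n k : ℕ} {P : Set (Rn n)}
    {L : AffineSubspace ℝ (Matrix (Fin k) (Fin k) ℝ)} {π : Matrix (Fin k) (Fin k) ℝ →ₗ[ℝ] Rn n}
    (hP : P = π '' (psdCone k ∩ (L : Set (Matrix (Fin k) (Fin k) ℝ))))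
    (hb : Bornology.IsBounded P) (hnt : P.Nontrivial)
    {M : Matrix (Fin k) (Fin k) ℝ} (hM : M.PosSemidef) (hML : M ∈ L)
    (hker : ∀ x : Fin k → ℝ, M *ᵥ x = 0 → x = 0)
    (l : Rn n →ₗ[ℝ] ℝ) (c : ℝ) (hl : ∀ p ∈ P, 0 ≤ l p + c) :
    ∃ B : Matrix (Fin k) (Fin k) ℝ, B.PosSemidef ∧
      ∀ u : Fin k → ℝ, vecMulVec u u ∈ L → u ⬝ᵥ B *ᵥ u = l (π (vecMulVec u u)) + c := by
  let f : (Matrix (Fin k) (Fin k) ℝ × ℝ) →ₗ.[ℝ] ℝ :=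
    ⟨homogenization L.direction M,
      ((l.comp π).coprod (c • LinearMap.id)).comp (homogenization L.direction M).subtype⟩
  have hf : ∀ Z : f.domain, f Z = l (π Z.1.1) + c * Z.1.2 := fun Z => rfl
  obtain ⟨g, hgf, hg⟩ := riesz_extension (quadCone k) f (by
    rintro ⟨⟨X, t⟩, hXs, hXL⟩ hXq
    simp only at hXs hXL hXq
    rw [hf]
    have hX : X.PosSemidef := psd_iff.mpr ⟨hXs, hXq⟩
    show 0 ≤ l (π X) + c * t
    rcases lt_trichotomy t 0 with ht | ht | ht
    -- For `t < 0`, adding the rescaled `X` to any lift `A` gives a psd recession direction, so `π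
    -- A` would be the same for all `A`, and `P` a single point.
    · exfalso
      have hst : 0 < (-t)⁻¹ := inv_pos.mpr (by linarith)
      have hconst : ∀ p ∈ P, p = -π ((-t)⁻¹ • X) := by
        intro p hp
        rw [hP] at hp
        obtain ⟨A, ⟨hA, hAL⟩, rfl⟩ := hp
        have hd : A + (-t)⁻¹ • X ∈ L.direction := by
          have h1 := L.direction.smul_mem (-t)⁻¹ hXL
          have h2 := L.direction.add_mem h1 (AffineSubspace.vsub_mem_direction hAL hML)
          convert h2 using 1
          rw [smul_sub, smul_smul]
          have : (-t)⁻¹ * t = -1 := by rw [inv_neg, neg_mul, inv_mul_cancel₀ ht.ne]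
          rw [this, vsub_eq_sub, neg_one_smul]; abel
        have := map_eq_zero_of_recession hP hb hM hML
          (Matrix.PosSemidef.add hA (hX.smul hst.le)) hd
        rw [map_add] at this
        exact eq_neg_of_add_eq_zero_left this
      obtain ⟨p, hp, q, hq, hpq⟩ := hnt
      exact hpq ((hconst p hp).trans (hconst q hq).symm)
    · subst ht
      rw [zero_smul, sub_zero] at hXL
      rw [map_eq_zero_of_recession hP hb hM hML hX hXL]
      simp
    · have hmem : π (t⁻¹ • X) ∈ P := by
        rw [hP]
        refine ⟨t⁻¹ • X, ⟨hX.smul (inv_pos.mpr ht).le, ?_⟩, rfl⟩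
        have h1 := AffineSubspace.vadd_mem_of_mem_direction
          (L.direction.smul_mem t⁻¹ hXL) hML
        have h2 : t⁻¹ • (X - t • M) +ᵥ M = t⁻¹ • X := by
          rw [smul_sub, smul_smul, inv_mul_cancel₀ ht.ne', one_smul, vadd_eq_add]; abel
        rwa [h2] at h1
      have h1 := mul_nonneg ht.le (hl _ hmem)
      rw [map_smul, map_smul, smul_eq_mul, mul_add, ← mul_assoc, mul_inv_cancel₀ ht.ne',
        one_mul] at h1
      linarith) (by
    -- Since `M` is positive definite, a large multiple of `(M, 1)` moves any `(Y, s)` into the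
    -- cone.
    rintro ⟨Y, s⟩
    obtain ⟨N, hN, hY⟩ := exists_neg_quad_le Y
    obtain ⟨d, hd, hle⟩ := psd_le_smul_of_ker_le (Y := 1) hM Matrix.PosSemidef.one
      (fun x hx => by rw [hker x hx, Matrix.mulVec_zero])
    refine ⟨⟨((N * d) • M, N * d), by simp [(psd_iff.mp hM).1], by simp⟩, fun x => ?_⟩
    show 0 ≤ x ⬝ᵥ ((N * d) • M + Y) *ᵥ x
    rw [Matrix.add_mulVec, Matrix.smul_mulVec, dotProduct_add, dotProduct_smul, smul_eq_mul]
    have h1 := hY x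
    have h2 := mul_le_mul_of_nonneg_left (hle x) hN
    rw [Matrix.one_mulVec] at h2
    linarith)
  have hquad : ∀ x : Fin k → ℝ,
      x ⬝ᵥ (Matrix.of fun i j => (g (Matrix.single i j 1, 0) + g (Matrix.single j i 1, 0)) / 2) *ᵥ x
        = g (vecMulVec x x, 0) := by
    intro x
    have hexp : (vecMulVec x x, (0 : ℝ)) =
        ∑ i, ∑ j, (x i * x j) • (Matrix.single i j (1 : ℝ), (0 : ℝ)) := by
      refine Prod.ext ?_ (by simp [Prod.snd_sum])
      simp only [Prod.fst_sum, Prod.smul_fst, Matrix.smul_single, smul_eq_mul, mul_one]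
      exact Matrix.matrix_eq_sum_single _
    have hg1 : g (vecMulVec x x, 0) = ∑ i, ∑ j, x i * x j * g (Matrix.single i j 1, 0) := by
      rw [hexp]; simp only [map_sum, map_smul, smul_eq_mul]
    have hg2 : g (vecMulVec x x, 0) = ∑ i, ∑ j, x i * x j * g (Matrix.single j i 1, 0) := by
      rw [hg1, Finset.sum_comm]
      exact Finset.sum_congr rfl fun i _ => Finset.sum_congr rfl fun j _ => by ring
    have : g (vecMulVec x x, 0) = (∑ i, ∑ j, x i * x j * g (Matrix.single i j 1, 0) +
        ∑ i, ∑ j, x i * x j * g (Matrix.single j i 1, 0)) / 2 := by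
      rw [← hg1, ← hg2]; ring
    rw [this, ← Finset.sum_add_distrib, Finset.sum_div]
    simp only [dotProduct, mulVec, Finset.mul_sum, Matrix.of_apply]
    refine Finset.sum_congr rfl fun i _ => ?_
    rw [← Finset.sum_add_distrib, Finset.sum_div]
    exact Finset.sum_congr rfl fun j _ => by ring
  refine ⟨Matrix.of fun i j => (g (Matrix.single i j 1, 0) + g (Matrix.single j i 1, 0)) / 2,
    psd_iff.mpr ⟨?_, fun x => ?_⟩, fun u hu => ?_⟩
  · ext i j
    simp [add_comm]
  · rw [hquad]
    exact hg _ fun y => by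
      rw [quad_vecMulVec]; positivity
  · rw [hquad]
    -- The cone does not constrain the second coordinate, so it contains both `(0, 1)` and `(0,
    -- -1)`; thus `g` depends on the matrix alone.
    have hzero : g ((0 : Matrix (Fin k) (Fin k) ℝ), (1 : ℝ)) = 0 := by
      have h1 := hg ((0 : Matrix (Fin k) (Fin k) ℝ), (1 : ℝ)) (fun x => by simp)
      have h2 := hg ((0 : Matrix (Fin k) (Fin k) ℝ), (-1 : ℝ)) (fun x => by simp)
      have h3 : ((0 : Matrix (Fin k) (Fin k) ℝ), (-1 : ℝ)) = -(0, 1) := by simp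
      rw [h3, map_neg] at h2
      linarith
    have h1 := hgf ⟨(vecMulVec u u, 1), (psd_iff.mp (psd_vecMulVec u)).1, by
      rw [one_smul]; exact AffineSubspace.vsub_mem_direction hu hML⟩
    rw [hf] at h1
    have h2 : (vecMulVec u u, (1 : ℝ)) = (vecMulVec u u, (0 : ℝ)) + (0, 1) := by simp
    simp only [h2, map_add, hzero, add_zero] at h1
    simpa using h1

/-! ### Orientation and the cyclic order of points in convex position -/

/-- Twice the signed area of the triangle `a b c`. -/
def orient (a b c : Rn 2) : ℝ :=
  (b 0 - a 0) * (c 1 - a 1) - (b 1 - a 1) * (c 0 - a 0)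

theorem orient_rotate (a b c : Rn 2) : orient b c a = orient a b c := by
  unfold orient; ring

theorem orient_swap (a b c : Rn 2) : orient b a c = -orient a b c := by
  unfold orient; ring

@[simp] theorem orient_self_left (a b : Rn 2) : orient a b a = 0 := by
  unfold orient; ring

@[simp] theorem orient_self_right (a b : Rn 2) : orient a b b = 0 := by
  unfold orient; ring

theorem orient_plucker (a b c d e : Rn 2) :
    orient c d a * orient d e b = orient d e c * orient a b d + orient d e a * orient b c d := by
  unfold orient; ring

/-- The linear part of `orient a b`. -/
noncomputable def orientLinear (a b : Rn 2) : Rn 2 →ₗ[ℝ] ℝ :=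
  (b 0 - a 0) • (EuclideanSpace.proj 1 : Rn 2 →L[ℝ] ℝ).toLinearMap -
    (b 1 - a 1) • (EuclideanSpace.proj 0 : Rn 2 →L[ℝ] ℝ).toLinearMap

theorem orientLinear_apply (a b p : Rn 2) :
    orientLinear a b p = (b 0 - a 0) * p 1 - (b 1 - a 1) * p 0 := by
  simp [orientLinear]

theorem orient_eq_orientLinear (a b p : Rn 2) :
    orient a b p = orientLinear a b p + -orientLinear a b a := by
  rw [orientLinear_apply, orientLinear_apply]; unfold orient; ring

/-- A point on the left of (or on) all edges of a positively oriented triangle belongs to it. -/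
theorem mem_convexHull_of_orient {a b c x : Rn 2} (hab : 0 ≤ orient a b x)
    (hbc : 0 ≤ orient b c x) (hca : 0 ≤ orient c a x) (h : 0 < orient a b c) :
    x ∈ convexHull ℝ ({a, b, c} : Set (Rn 2)) := by
  have hs : orient b c x + orient c a x + orient a b x = orient a b c := by unfold orient; ring
  have hx : x = (orient b c x / orient a b c) • a + (orient c a x / orient a b c) • b +
      (orient a b x / orient a b c) • c := by
    ext i
    fin_cases i <;>
    · simp only [PiLp.add_apply, PiLp.smul_apply, smul_eq_mul]
      field_simp
      simp [orient]; ring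
  have hconv := convex_convexHull ℝ ({a, b, c} : Set (Rn 2))
  have hsub := subset_convexHull ℝ ({a, b, c} : Set (Rn 2))
  have := hconv.sum_mem (t := Finset.univ)
    (w := ![orient b c x / orient a b c, orient c a x / orient a b c, orient a b x / orient a b c])
    (z := ![a, b, c])
    (by intro i _; fin_cases i <;> simp <;> positivity)
    (by simp [Fin.sum_univ_three]; field_simp; exact hs)
    (by intro i _; apply hsub; fin_cases i <;> simp)
  rw [hx]
  simpa [Fin.sum_univ_three] using this

/-- Every point of `V` is outside the convex hull of the others. -/
def ConvexPosition (V : Set (Rn 2)) : Prop :=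
  ∀ v ∈ V, v ∉ convexHull ℝ (V \ {v})

theorem ConvexPosition.notMem_of_subset {V : Set (Rn 2)} (hV : ConvexPosition V) {x : Rn 2}
    (hx : x ∈ V) {S : Set (Rn 2)} (hS : S ⊆ V) (hxS : x ∉ S) : x ∉ convexHull ℝ S :=
  fun h => hV x hx (convexHull_mono (Set.subset_sdiff_singleton hS hxS) h)

/-- `w` is the vertex following `v` in the counterclockwise order. -/
def IsNext (V : Set (Rn 2)) (v w : Rn 2) : Prop :=
  w ∈ V ∧ w ≠ v ∧ ∀ x ∈ V, x ≠ v → x ≠ w → 0 < orient v w x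

/-- A line separates `v` from the other points, so these are seen from `v` within an open
half-plane; the next vertex has the least slope there. -/
theorem ConvexPosition.exists_isNext {V : Set (Rn 2)} (hV : ConvexPosition V) (hfin : V.Finite)
    {v : Rn 2} (hv : v ∈ V) (hne : (V \ {v}).Nonempty) : ∃ w, IsNext V v w := by
  have hfin' : (V \ {v}).Finite := hfin.subset Set.sdiff_subset
  obtain ⟨F, s, hFv, hF⟩ := geometric_hahn_banach_point_closed
    (convex_convexHull ℝ (V \ {v})) (hfin'.isCompact_convexHull ℝ).isClosed (hV v hv)
  have hFlin : ∀ p : Rn 2, F p = p 0 * F (EuclideanSpace.single 0 1) +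
      p 1 * F (EuclideanSpace.single 1 1) := by
    intro p
    have hp : p = p 0 • EuclideanSpace.single 0 (1 : ℝ) + p 1 • EuclideanSpace.single 1 (1 : ℝ) := by
      ext i; fin_cases i <;> simp
    conv_lhs => rw [hp]
    simp
  set α := F (EuclideanSpace.single 0 1)
  set β := F (EuclideanSpace.single 1 1)
  let G : Rn 2 → ℝ := fun p => α * p 1 - β * p 0
  have hpos : ∀ x ∈ V \ {v}, 0 < F x - F v := fun x hx => by
    have := hF x (subset_convexHull ℝ _ hx)
    linarith
  have hdet : ∀ x y : Rn 2, (F x - F v) * (G y - G v) - (G x - G v) * (F y - F v) =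
      (α ^ 2 + β ^ 2) * orient v x y := by
    intro x y
    rw [hFlin x, hFlin v, hFlin y]; simp only [G]; unfold orient; ring
  have hab : 0 < α ^ 2 + β ^ 2 := by
    obtain ⟨x, hx⟩ := hne
    have h1 := hpos x hx
    rw [hFlin x, hFlin v] at h1
    by_contra hcon
    have hα : α = 0 := by nlinarith [sq_nonneg α, sq_nonneg β]
    have hβ : β = 0 := by nlinarith [sq_nonneg α, sq_nonneg β]
    rw [hα, hβ] at h1
    simp at h1
  obtain ⟨w, hw, hmin⟩ := Set.exists_min_image (V \ {v})
    (fun x => (G x - G v) / (F x - F v)) hfin' hne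
  refine ⟨w, hw.1, hw.2, fun x hx hxv hxw => ?_⟩
  have hx' : x ∈ V \ {v} := ⟨hx, hxv⟩
  have h1 := hmin x hx'
  rw [div_le_div_iff₀ (hpos w hw) (hpos x hx')] at h1
  have h2 := hdet w x
  have h3 : 0 ≤ orient v w x := by
    by_contra hcon
    push Not at hcon
    nlinarith [mul_neg_of_pos_of_neg hab hcon]
  refine lt_of_le_of_ne h3 fun h4 => ?_
  have hfw := hpos w hw
  have hfx := hpos x hx'
  -- A tie would put `w` and `x` on one ray from `v`; the nearer would lie on the segment from `v`
  -- to the farther, against convex position.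
  have hcol : ∀ i, (F w - F v) * (x i - v i) = (F x - F v) * (w i - v i) := by
    intro i
    unfold orient at h4
    rw [hFlin w, hFlin x, hFlin v]
    fin_cases i
    · simp only [Fin.zero_eta, Fin.isValue]; linear_combination β * h4
    · simp only [Fin.mk_one, Fin.isValue]; linear_combination (-α) * h4
  have hseg : ∀ y z : Rn 2, 0 < F y - F v → 0 < F z - F v → F y ≤ F z →
      (∀ i, (F z - F v) * (y i - v i) = (F y - F v) * (z i - v i)) → y ∈ segment ℝ v z := by
    intro y z hy hz hyz hc
    rw [segment_eq_image']
    refine ⟨(F y - F v) / (F z - F v), ⟨by positivity, by rw [div_le_one hz]; linarith⟩, ?_⟩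
    ext i
    simp only [PiLp.add_apply, PiLp.smul_apply, PiLp.sub_apply, smul_eq_mul]
    field_simp
    linarith [hc i]
  rcases le_total (F x) (F w) with h | h
  · refine hV.notMem_of_subset hx (S := {v, w}) ?_ (by simp [hxv, hxw]) ?_
    · rintro y (rfl | rfl)
      exacts [hv, hw.1]
    · rw [convexHull_pair]
      exact hseg x w hfx hfw h hcol
  · refine hV.notMem_of_subset hw.1 (S := {v, x}) ?_ ?_ ?_
    · rintro y (rfl | rfl)
      exacts [hv, hx]
    · have := hw.2
      simp only [Set.mem_singleton_iff] at this
      simp [this, Ne.symm hxw]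
    · rw [convexHull_pair]
      exact hseg w x hfw hfx h fun i => (hcol i).symm

theorem IsNext.ne_prev {V : Set (Rn 2)} {a b c x : Rn 2} (hab : IsNext V a b)
    (hbc : IsNext V b c) (hx : x ∈ V) (hxa : x ≠ a) (hxb : x ≠ b) : c ≠ a := by
  rintro rfl
  have h1 := hab.2.2 x hx hxa hxb
  have h2 := hbc.2.2 x hx hxb hxa
  rw [orient_swap] at h2
  linarith

/-- If the walk closed up after three steps, any further vertex would lie to the left of all three
sides, hence inside the triangle. -/
theorem IsNext.ne_prev_prev {V : Set (Rn 2)} (hV : ConvexPosition V) {a b c d x : Rn 2}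
    (ha : a ∈ V) (hab : IsNext V a b) (hbc : IsNext V b c) (hcd : IsNext V c d) (hca : c ≠ a)
    (hx : x ∈ V) (hxa : x ≠ a) (hxb : x ≠ b) (hxc : x ≠ c) : d ≠ a := by
  rintro rfl
  refine hV.notMem_of_subset hx (S := {d, b, c}) ?_ (by simp [hxa, hxb, hxc])
    (mem_convexHull_of_orient (hab.2.2 x hx hxa hxb).le (hbc.2.2 x hx hxb hxc).le
      (hcd.2.2 x hx hxc hxa).le (hab.2.2 c hbc.1 hca hbc.2.1))
  rintro y (rfl | rfl | rfl)
  exacts [ha, hab.1, hbc.1]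

theorem IsNext.ne_prev_prev_prev {V : Set (Rn 2)} (hV : ConvexPosition V) {a b c d e x : Rn 2}
    (ha : a ∈ V) (hab : IsNext V a b) (hbc : IsNext V b c) (hcd : IsNext V c d)
    (hde : IsNext V d e) (hca : c ≠ a) (hda : d ≠ a)
    (hx : x ∈ V) (hxa : x ≠ a) (hxb : x ≠ b) (hxc : x ≠ c) (hxd : x ≠ d) : e ≠ a := by
  rintro rfl
  -- With `e = a`, the diagonal from `c` to `e` cuts the quadrilateral into two triangles, one of
  -- which contains `x`.
  rcases le_total 0 (orient c e x) with h | h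
  · refine hV.notMem_of_subset hx (S := {e, b, c}) ?_ (by simp [hxa, hxb, hxc])
      (mem_convexHull_of_orient (hab.2.2 x hx hxa hxb).le (hbc.2.2 x hx hxb hxc).le h
        (hab.2.2 c hbc.1 hca hbc.2.1))
    rintro y (rfl | rfl | rfl)
    exacts [ha, hab.1, hbc.1]
  · have h' : 0 ≤ orient e c x := by rw [orient_swap]; linarith
    have hpos : 0 < orient e c d := by
      have := hcd.2.2 e ha hca.symm hda.symm
      rwa [orient_rotate e c d] at this
    refine hV.notMem_of_subset hx (S := {e, c, d}) ?_ (by simp [hxa, hxc, hxd])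
      (mem_convexHull_of_orient h' (hcd.2.2 x hx hxc hxd).le (hde.2.2 x hx hxd hxa).le hpos)
    rintro y (rfl | rfl | rfl)
    exacts [ha, hbc.1, hcd.1]

theorem convex_setOf_orient_nonneg (a b : Rn 2) : Convex ℝ {p | 0 ≤ orient a b p} := by
  have : {p | 0 ≤ orient a b p} = {p | orientLinear a b a ≤ orientLinear a b p} := by
    ext p
    simp only [Set.mem_ofPred_eq, orient_eq_orientLinear]
    constructor <;> intro h <;> linarith
  rw [this]
  exact convex_halfSpace_ge (orientLinear a b).isLinear _

theorem IsNext.orient_nonneg {V : Set (Rn 2)} {a b : Rn 2} (h : IsNext V a b) {p : Rn 2}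
    (hp : p ∈ convexHull ℝ V) : 0 ≤ orient a b p := by
  refine convexHull_min (fun x hx => ?_) (convex_setOf_orient_nonneg a b) hp
  show 0 ≤ orient a b x
  by_cases hxa : x = a
  · rw [hxa, orient_self_left]
  by_cases hxb : x = b
  · rw [hxb, orient_self_right]
  exact (h.2.2 x hx hxa hxb).le

/-! ### The kernel chain and the lower bound on the size of a lift -/

/-- An edge `p q` of the convex set `P` with an extreme end point `p`. -/
structure IsEdge (P : Set (Rn 2)) (p q : Rn 2) : Prop where
  left_mem : p ∈ P.extremePoints ℝ
  right_mem : q ∈ P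
  ne : q ≠ p
  orient_nonneg : ∀ x ∈ P, 0 ≤ orient p q x

theorem IsNext.isEdge {P : Set (Rn 2)} (hP : P = convexHull ℝ (P.extremePoints ℝ)) {a b : Rn 2}
    (ha : a ∈ P.extremePoints ℝ) (h : IsNext (P.extremePoints ℝ) a b) : IsEdge P a b :=
  ⟨ha, extremePoints_subset h.1, h.2.1, fun x hx => h.orient_nonneg (by rwa [hP] at hx)⟩

section Lift

variable {k : ℕ} {P : Set (Rn 2)} {L : AffineSubspace ℝ (Matrix (Fin k) (Fin k) ℝ)}
  {π : Matrix (Fin k) (Fin k) ℝ →ₗ[ℝ] Rn 2}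

theorem not_ker_le_of_extreme
    (hP : P = π '' (psdCone k ∩ (L : Set (Matrix (Fin k) (Fin k) ℝ))))
    {A B : Matrix (Fin k) (Fin k) ℝ} (hA : A.PosSemidef) (hB : B.PosSemidef) (hAL : A ∈ L)
    (hBL : B ∈ L) (hext : π A ∈ P.extremePoints ℝ) (hne : π B ≠ π A) :
    ∃ x : Fin k → ℝ, A.mulVec x = 0 ∧ B.mulVec x ≠ 0 := by
  by_contra hcon
  push Not at hcon
  obtain ⟨ε, hε, hmem⟩ := exists_prolong hP hA hB hAL hBL hcon
  have hBP : π B ∈ P := by rw [hP]; exact ⟨B, ⟨hB, hBL⟩, rfl⟩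
  refine hne ((mem_extremePoints.mp hext).2 _ hBP _ hmem ?_).1
  rw [openSegment_eq_image']
  -- `π A` divides the segment from `π B` to the prolonged point in the ratio `1 : ε`.
  refine ⟨1 / (1 + ε), ⟨by positivity, by rw [div_lt_one (by positivity)]; linarith⟩, ?_⟩
  have : π A + ε • (π A - π B) - π B = (1 + ε) • (π A - π B) := by
    rw [add_smul, one_smul]; abel
  simp only [this, smul_smul]
  rw [one_div, inv_mul_cancel₀ (by positivity), one_smul]; abel

theorem not_ker_le_of_edge
    (hP : P = π '' (psdCone k ∩ (L : Set (Matrix (Fin k) (Fin k) ℝ))))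
    {A B C : Matrix (Fin k) (Fin k) ℝ} (hA : A.PosSemidef) (hB : B.PosSemidef)
    (hC : C.PosSemidef) (hAL : A ∈ L) (hBL : B ∈ L) (hCL : C ∈ L)
    (he : ∀ x ∈ P, 0 ≤ orient (π A) (π B) x) (hpos : 0 < orient (π A) (π B) (π C)) :
    ∃ x : Fin k → ℝ, A.mulVec x = 0 ∧ B.mulVec x = 0 ∧ C.mulVec x ≠ 0 := by
  by_contra hcon
  push Not at hcon
  -- Prolonging from `C` through the midpoint of `A` and `B` would project to a point strictly
  -- beyond the edge.
  have hmid : (1 / 2 : ℝ) • A + (1 / 2 : ℝ) • B ∈ L :=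
    L.convex hAL hBL (by norm_num) (by norm_num) (by norm_num)
  have hA2 := hA.smul (show (0 : ℝ) ≤ 1 / 2 by norm_num)
  have hB2 := hB.smul (show (0 : ℝ) ≤ 1 / 2 by norm_num)
  obtain ⟨ε, hε, hmem⟩ := exists_prolong hP (hA2.add hB2) hC hmid hCL (by
    intro x hx
    rw [psd_add_mulVec_eq_zero_iff hA2 hB2, Matrix.smul_mulVec, Matrix.smul_mulVec] at hx
    exact hcon x (by simpa using hx.1) (by simpa using hx.2))
  have h := he _ hmem
  have h2 : orient (π A) (π B) (π ((1 / 2 : ℝ) • A + (1 / 2 : ℝ) • B) +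
      ε • (π ((1 / 2 : ℝ) • A + (1 / 2 : ℝ) • B) - π C)) = -ε * orient (π A) (π B) (π C) := by
    simp only [map_add, map_smul]
    unfold orient
    simp only [PiLp.add_apply, PiLp.smul_apply, PiLp.sub_apply, smul_eq_mul]
    ring
  rw [h2] at h
  nlinarith [mul_pos hε hpos]

/-- If `0 ∈ L`, then `L` is linear and `B` is itself a recession direction, so `π B = 0`. -/
theorem ne_zero_of_lift
    (hP : P = π '' (psdCone k ∩ (L : Set (Matrix (Fin k) (Fin k) ℝ))))
    (hb : Bornology.IsBounded P)
    {A B : Matrix (Fin k) (Fin k) ℝ} (hB : B.PosSemidef) (hAL : A ∈ L)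
    (hBL : B ∈ L) (hne : π B ≠ π A) : A ≠ 0 := by
  rintro rfl
  refine hne ?_
  have hd : B ∈ L.direction := by simpa using AffineSubspace.vsub_mem_direction hBL hAL
  rw [map_eq_zero_of_recession hP hb Matrix.PosSemidef.zero hAL hB hd, map_zero]

/-- The kernels of lifts of a vertex, an edge and the whole polygon form a strict chain. -/
theorem finrank_ker_chain
    (hP : P = π '' (psdCone k ∩ (L : Set (Matrix (Fin k) (Fin k) ℝ))))
    (hb : Bornology.IsBounded P)
    {A B C : Matrix (Fin k) (Fin k) ℝ} (hA : A.PosSemidef) (hB : B.PosSemidef)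
    (hC : C.PosSemidef) (hAL : A ∈ L) (hBL : B ∈ L) (hCL : C ∈ L)
    (he : IsEdge P (π A) (π B)) (hpos : 0 < orient (π A) (π B) (π C)) :
    Module.finrank ℝ (LinearMap.ker (A + B + C).mulVecLin) + 2 ≤
        Module.finrank ℝ (LinearMap.ker A.mulVecLin) ∧
      Module.finrank ℝ (LinearMap.ker A.mulVecLin) < k := by
  obtain ⟨x, hx1, hx2⟩ := not_ker_le_of_extreme hP hA hB hAL hBL he.left_mem he.ne
  obtain ⟨y, hy1, hy2, hy3⟩ :=
    not_ker_le_of_edge hP hA hB hC hAL hBL hCL he.orient_nonneg hpos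
  have h1 : LinearMap.ker (A + B).mulVecLin < LinearMap.ker A.mulVecLin := by
    rw [SetLike.lt_iff_le_and_exists]
    refine ⟨fun z hz => ((psd_add_mulVec_eq_zero_iff hA hB z).mp hz).1, x, hx1, fun h => hx2 ?_⟩
    exact ((psd_add_mulVec_eq_zero_iff hA hB x).mp h).2
  have h2 : LinearMap.ker (A + B + C).mulVecLin < LinearMap.ker (A + B).mulVecLin := by
    rw [SetLike.lt_iff_le_and_exists]
    refine ⟨fun z hz => ((psd_add_mulVec_eq_zero_iff (hA.add hB) hC z).mp hz).1, y,
      (psd_add_mulVec_eq_zero_iff hA hB y).mpr ⟨hy1, hy2⟩, fun h => hy3 ?_⟩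
    exact ((psd_add_mulVec_eq_zero_iff (hA.add hB) hC y).mp h).2
  have h3 : LinearMap.ker A.mulVecLin ≠ ⊤ := by
    intro h
    refine ne_zero_of_lift hP hb hB hAL hBL he.ne ?_
    rw [LinearMap.ker_eq_top] at h
    ext i j
    have := congrFun (LinearMap.congr_fun h (Pi.single j 1)) i
    simpa using this
  have h4 := Submodule.finrank_lt h3
  rw [Module.finrank_fin_fun] at h4
  have h5 := Submodule.finrank_lt_finrank_of_lt h1
  have h6 := Submodule.finrank_lt_finrank_of_lt h2
  exact ⟨by omega, h4⟩

end Lift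

theorem exists_lift_point {n k : ℕ} {P : Set (Rn n)}
    {L : AffineSubspace ℝ (Matrix (Fin k) (Fin k) ℝ)} {π : Matrix (Fin k) (Fin k) ℝ →ₗ[ℝ] Rn n}
    (hP : P = π '' (psdCone k ∩ (L : Set (Matrix (Fin k) (Fin k) ℝ)))) {p : Rn n} (hp : p ∈ P) :
    ∃ A : Matrix (Fin k) (Fin k) ℝ, A.PosSemidef ∧ A ∈ L ∧ π A = p := by
  rw [hP] at hp
  obtain ⟨A, ⟨h1, h2⟩, h3⟩ := hp
  exact ⟨A, h1, h2, h3⟩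

theorem three_le_of_hasPsdLift {k : ℕ} {P : Set (Rn 2)} (hb : Bornology.IsBounded P)
    {p q r : Rn 2} (he : IsEdge P p q) (hr : r ∈ P) (hpos : 0 < orient p q r)
    (h : HasPsdLift k P) : 3 ≤ k := by
  obtain ⟨L, π, hP⟩ := h
  obtain ⟨A, hA, hAL, rfl⟩ := exists_lift_point hP (extremePoints_subset he.left_mem)
  obtain ⟨B, hB, hBL, rfl⟩ := exists_lift_point hP he.right_mem
  obtain ⟨C, hC, hCL, rfl⟩ := exists_lift_point hP hr
  have := finrank_ker_chain hP hb hA hB hC hAL hBL hCL he hpos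
  omega

/-! ### Lifts of size three: rank-one vertices and square slacks -/

section SizeThree

variable {P : Set (Rn 2)} {L : AffineSubspace ℝ (Matrix (Fin 3) (Fin 3) ℝ)}
  {π : Matrix (Fin 3) (Fin 3) ℝ →ₗ[ℝ] Rn 2}

-- In dimension three the kernel chain forces `ker A` to have dimension exactly two.
open Matrix in
theorem exists_rankOne_lift
    (hP : P = π '' (psdCone 3 ∩ (L : Set (Matrix (Fin 3) (Fin 3) ℝ))))
    (hb : Bornology.IsBounded P) {p q r : Rn 2} (he : IsEdge P p q) (hr : r ∈ P)
    (hpos : 0 < orient p q r) :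
    ∃ u : Fin 3 → ℝ, vecMulVec u u ∈ L ∧ π (vecMulVec u u) = p := by
  obtain ⟨A, hA, hAL, rfl⟩ := exists_lift_point hP (extremePoints_subset he.left_mem)
  obtain ⟨B, hB, hBL, rfl⟩ := exists_lift_point hP he.right_mem
  obtain ⟨C, hC, hCL, rfl⟩ := exists_lift_point hP hr
  have := finrank_ker_chain hP hb hA hB hC hAL hBL hCL he hpos
  obtain ⟨u, rfl⟩ := exists_eq_vecMulVec hA (by omega)
  exact ⟨u, hAL, rfl⟩

theorem exists_slater
    (hP : P = π '' (psdCone 3 ∩ (L : Set (Matrix (Fin 3) (Fin 3) ℝ))))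
    (hb : Bornology.IsBounded P) {p q r : Rn 2} (he : IsEdge P p q) (hr : r ∈ P)
    (hpos : 0 < orient p q r) :
    ∃ M : Matrix (Fin 3) (Fin 3) ℝ, M.PosSemidef ∧ M ∈ L ∧
      ∀ x : Fin 3 → ℝ, M.mulVec x = 0 → x = 0 := by
  obtain ⟨A, hA, hAL, rfl⟩ := exists_lift_point hP (extremePoints_subset he.left_mem)
  obtain ⟨B, hB, hBL, rfl⟩ := exists_lift_point hP he.right_mem
  obtain ⟨C, hC, hCL, rfl⟩ := exists_lift_point hP hr
  have hch := finrank_ker_chain hP hb hA hB hC hAL hBL hCL he hpos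
  have hker : LinearMap.ker (A + B + C).mulVecLin = ⊥ := Submodule.finrank_eq_zero.mp (by omega)
  refine ⟨(1 / 3 : ℝ) • (A + B + C), ((hA.add hB).add hC).smul (by norm_num), ?_, fun x hx => ?_⟩
  · have h1 := L.convex hAL hBL (show (0 : ℝ) ≤ 1 / 2 by norm_num)
      (show (0 : ℝ) ≤ 1 / 2 by norm_num) (by norm_num)
    have h2 := L.convex h1 hCL (show (0 : ℝ) ≤ 2 / 3 by norm_num)
      (show (0 : ℝ) ≤ 1 / 3 by norm_num) (by norm_num)
    convert h2 using 1
    simp only [smul_add, smul_smul]; norm_num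
  · rw [Matrix.smul_mulVec, smul_eq_zero] at hx
    have hmem : x ∈ LinearMap.ker (A + B + C).mulVecLin := hx.resolve_left (by norm_num)
    rwa [hker] at hmem

open Matrix in
/-- In a lift of size three, the slack of an edge at the vertices is the square of a linear form
in the rank-one lifts of the vertices. -/
theorem exists_sqrt_slack
    (hP : P = π '' (psdCone 3 ∩ (L : Set (Matrix (Fin 3) (Fin 3) ℝ))))
    (hb : Bornology.IsBounded P) {p q r : Rn 2} (he : IsEdge P p q) (hr : r ∈ P)
    (hpos : 0 < orient p q r) {u v : Fin 3 → ℝ} (huL : vecMulVec u u ∈ L)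
    (hvL : vecMulVec v v ∈ L) (hu : π (vecMulVec u u) = p) (hv : π (vecMulVec v v) = q) :
    ∃ w : Fin 3 → ℝ, ∀ x : Fin 3 → ℝ, vecMulVec x x ∈ L →
      (x ⬝ᵥ w) ^ 2 = orient p q (π (vecMulVec x x)) := by
  obtain ⟨M, hM, hML, hMker⟩ := exists_slater hP hb he hr hpos
  obtain ⟨B, hB, hBq⟩ := exists_dual_psd hP hb
    ⟨p, extremePoints_subset he.left_mem, q, he.right_mem, he.ne.symm⟩ hM hML hMker
    (orientLinear p q) (-orientLinear p q p)
    (fun x hx => by rw [← orient_eq_orientLinear]; exact he.orient_nonneg x hx)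
  simp only [← orient_eq_orientLinear] at hBq
  have hBu : B *ᵥ u = 0 := (psd_mulVec_eq_zero_iff hB u).mp (by
    rw [hBq u huL, hu, orient_self_left])
  have hBv : B *ᵥ v = 0 := (psd_mulVec_eq_zero_iff hB v).mp (by
    rw [hBq v hvL, hv, orient_self_right])
  have hu0 : u ≠ 0 := by
    have := ne_zero_of_lift hP hb (psd_vecMulVec v) huL hvL (by rw [hu, hv]; exact he.ne)
    rintro rfl
    exact this (by simp)
  -- If `v` were a multiple of `u`, the kernel of `u uᵀ` would lie in that of `v vᵀ`, which
  -- extremality of `p` excludes.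
  have hind : LinearIndependent ℝ ![u, v] := by
    rw [LinearIndependent.pair_iff' hu0]
    rintro a rfl
    obtain ⟨x, hx1, hx2⟩ := not_ker_le_of_extreme hP (psd_vecMulVec u) (psd_vecMulVec (a • u))
      huL hvL (by rw [hu]; exact he.left_mem) (by rw [hu, hv]; exact he.ne)
    rw [vecMulVec_mulVec_eq] at hx1 hx2
    rw [smul_eq_zero, or_iff_left hu0] at hx1
    exact hx2 (by rw [smul_dotProduct, hx1]; simp)
  have hfr : 2 ≤ Module.finrank ℝ (LinearMap.ker B.mulVecLin) := by
    have h1 := finrank_span_eq_card hind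
    rw [Fintype.card_fin] at h1
    refine h1.symm.le.trans ?_
    refine Submodule.finrank_mono (Submodule.span_le.mpr ?_)
    rintro _ ⟨i, rfl⟩
    fin_cases i
    exacts [hBu, hBv]
  obtain ⟨w, rfl⟩ := exists_eq_vecMulVec hB (by omega)
  exact ⟨w, fun x hx => by rw [← hBq x hx, quad_vecMulVec, dotProduct_comm]⟩

end SizeThree

/-! ### Five vertices have no square-root slack matrix of rank three -/

open Matrix in
theorem det_dotProduct_eq_zero {u w : Fin 4 → Fin 3 → ℝ} :
    (Matrix.of fun i j => u i ⬝ᵥ w j).det = 0 := by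
  have h : ¬ LinearIndependent ℝ u := fun h => by
    have := h.fintype_card_le_finrank
    simp at this
  rw [Fintype.not_linearIndependent_iff] at h
  obtain ⟨g, hg, i, hi⟩ := h
  refine Matrix.exists_vecMul_eq_zero_iff.mp ⟨g, fun h0 => hi (congrFun h0 i), ?_⟩
  ext j
  have : ((∑ i, g i • u i) ⬝ᵥ w j) = 0 := by rw [hg, zero_dotProduct]
  rw [sum_dotProduct] at this
  simpa [vecMul, dotProduct, Finset.mul_sum, mul_assoc] using this

open Matrix in
theorem no_sqrt_slack {u w : Fin 4 → Fin 3 → ℝ} {v : Fin 5 → Rn 2}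
    (h : ∀ i j : Fin 4, (u i ⬝ᵥ w j) ^ 2 = orient (v j.castSucc) (v j.succ) (v i.castSucc))
    (h120 : orient (v 1) (v 2) (v 0) ≠ 0) (h340 : orient (v 3) (v 4) (v 0) ≠ 0)
    (h231 : orient (v 2) (v 3) (v 1) ≠ 0) (h342 : orient (v 3) (v 4) (v 2) ≠ 0)
    (h013 : orient (v 0) (v 1) (v 3) ≠ 0) : False := by
  have hdet := det_dotProduct_eq_zero (u := u) (w := w)
  set t : Fin 4 → Fin 4 → ℝ := fun i j => u i ⬝ᵥ w j
  have hz : ∀ i : Fin 4, t i i = 0 := fun i => by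
    have := h i i
    rw [orient_self_left] at this
    exact pow_eq_zero_iff two_ne_zero |>.mp this
  have hz' : ∀ i j : Fin 4, i.castSucc = j.succ → t i j = 0 := fun i j hij => by
    have := h i j
    rw [hij, orient_self_right] at this
    exact pow_eq_zero_iff two_ne_zero |>.mp this
  have ht10 := hz' 1 0 rfl
  have ht21 := hz' 2 1 rfl
  have ht32 := hz' 3 2 rfl
  -- The vanishing determinant, expanded with `t i i = 0` and `t (i + 1) i = 0`.
  have key : t 0 2 * t 1 3 * (t 2 0 * t 3 1) =
      t 0 1 * t 1 2 * (t 2 3 * t 3 0) + t 0 3 * t 1 2 * (t 2 0 * t 3 1) := by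
    have h00 := hz 0
    have h11 := hz 1
    have h22 := hz 2
    have h33 := hz 3
    have e : (Matrix.of fun i j => u i ⬝ᵥ w j) = Matrix.of t := rfl
    rw [e] at hdet
    simp [Matrix.det_succ_row_zero, Fin.sum_univ_succ, Fin.succAbove, h00, h11, h22, h33, ht10,
      ht21, ht32] at hdet
    linear_combination hdet
  have s02 := h 0 2
  have s13 := h 1 3
  have s20 := h 2 0
  have s31 := h 3 1
  have s01 := h 0 1
  have s12 := h 1 2
  have s23 := h 2 3
  have s30 := h 3 0
  have s03 := h 0 3
  change t 0 2 ^ 2 = orient (v 2) (v 3) (v 0) at s02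
  change t 1 3 ^ 2 = orient (v 3) (v 4) (v 1) at s13
  change t 2 0 ^ 2 = orient (v 0) (v 1) (v 2) at s20
  change t 3 1 ^ 2 = orient (v 1) (v 2) (v 3) at s31
  change t 0 1 ^ 2 = orient (v 1) (v 2) (v 0) at s01
  change t 1 2 ^ 2 = orient (v 2) (v 3) (v 1) at s12
  change t 2 3 ^ 2 = orient (v 3) (v 4) (v 2) at s23
  change t 3 0 ^ 2 = orient (v 0) (v 1) (v 3) at s30
  change t 0 3 ^ 2 = orient (v 3) (v 4) (v 0) at s03
  rw [← s01] at h120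
  rw [← s12] at h231
  rw [← s23] at h342
  rw [← s30] at h013
  rw [← s03] at h340
  -- Both sides are twice the area of one triangle on three consecutive vertices; likewise in `e2`.
  have e1 : t 2 0 ^ 2 = t 0 1 ^ 2 := by rw [s20, s01, orient_rotate (v 0)]
  have e2 : t 3 1 ^ 2 = t 1 2 ^ 2 := by rw [s31, s12, orient_rotate (v 1)]
  have hp : t 0 2 ^ 2 * t 1 3 ^ 2 = t 2 3 ^ 2 * t 3 0 ^ 2 + t 0 3 ^ 2 * t 1 2 ^ 2 := by
    rw [← e2, s02, s13, s23, s30, s03, s31]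
    exact orient_plucker _ _ _ _ _
  have hsq : (t 0 2 * t 1 3 * (t 2 0 * t 3 1)) ^ 2 =
      (t 0 1 * t 1 2 * (t 2 3 * t 3 0)) ^ 2 + (t 0 3 * t 1 2 * (t 2 0 * t 3 1)) ^ 2 := by
    simp only [mul_pow, e1, e2]
    linear_combination (t 0 1 ^ 2 * t 1 2 ^ 2) * hp
  rw [key] at hsq
  -- Comparing `(Y + Z)² = Y² + Z²` leaves `Y * Z = 0`, whatever the signs of the roots.
  have hzero : t 0 1 * t 1 2 * (t 2 3 * t 3 0) * (t 0 3 * t 1 2 * (t 2 0 * t 3 1)) = 0 := by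
    linear_combination hsq / 2
  rw [← e1] at h120
  have h120' := e1 ▸ h120
  rw [← e2] at h231
  have h231' := e2 ▸ h231
  simp only [mul_eq_zero] at hzero
  simp only [ne_eq, pow_eq_zero_iff two_ne_zero] at h120 h120' h231 h231' h342 h013 h340
  tauto

/-! ### Explicit lifts of triangles and quadrilaterals -/

/-- The affine subspace on which the linear map `g` takes the value `c`. -/
def levelSubspace {E F : Type*} [AddCommGroup E] [Module ℝ E] [AddCommGroup F] [Module ℝ F]
    (g : E →ₗ[ℝ] F) (c : F) : AffineSubspace ℝ E where
  carrier := {X | g X = c}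
  smul_vsub_vadd_mem' t x y z hx hy hz := by
    simp only [Set.mem_ofPred_eq, vsub_eq_sub, vadd_eq_add, map_add, map_smul, map_sub] at *
    rw [hx, hy, hz, sub_self, smul_zero, zero_add]

theorem mem_levelSubspace {E F : Type*} [AddCommGroup E] [Module ℝ E] [AddCommGroup F]
    [Module ℝ F] {g : E →ₗ[ℝ] F} {c : F} {X : E} : X ∈ levelSubspace g c ↔ g X = c := Iff.rfl

theorem psd_diag_nonneg {k : ℕ} {X : Matrix (Fin k) (Fin k) ℝ} (hX : X.PosSemidef) (i : Fin k) :
    0 ≤ X i i := hX.diag_nonneg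

theorem psd_sq_le {k : ℕ} {X : Matrix (Fin k) (Fin k) ℝ} (hX : X.PosSemidef) (i j : Fin k) :
    X i j ^ 2 ≤ X i i * X j j := by
  have h := (hX.submatrix ![i, j]).det_nonneg
  rw [Matrix.det_fin_two] at h
  have hs : X j i = X i j := congrFun (congrFun (psd_iff.mp hX).1 i) j
  simp only [Matrix.submatrix_apply, Matrix.cons_val_zero, Matrix.cons_val_one, hs] at h
  nlinarith

theorem convex_image_lift {n k : ℕ} (L : AffineSubspace ℝ (Matrix (Fin k) (Fin k) ℝ))
    (π : Matrix (Fin k) (Fin k) ℝ →ₗ[ℝ] Rn n) :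
    Convex ℝ (π '' (psdCone k ∩ (L : Set (Matrix (Fin k) (Fin k) ℝ)))) := by
  refine Convex.linear_image (Convex.inter ?_ L.convex) π
  intro A hA B hB a b ha hb _
  exact Matrix.PosSemidef.add (Matrix.PosSemidef.smul hA ha) (Matrix.PosSemidef.smul hB hb)

open Matrix in
/-- A simplex with `k` vertices has a lift of size `k`. -/
theorem hasPsdLift_convexHull_range {n k : ℕ} (p : Fin k → Rn n) :
    HasPsdLift k (convexHull ℝ (Set.range p)) := by
  refine ⟨levelSubspace (Matrix.traceLinearMap (Fin k) ℝ ℝ) 1,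
    ∑ i, (Matrix.entryLinearMap ℝ ℝ i i).smulRight (p i), subset_antisymm ?_ ?_⟩
  · refine convexHull_min ?_ (convex_image_lift _ _)
    rintro _ ⟨i, rfl⟩
    refine ⟨vecMulVec (Pi.single i 1) (Pi.single i 1), ⟨psd_vecMulVec _, ?_⟩, ?_⟩
    · show (vecMulVec (Pi.single i (1 : ℝ)) (Pi.single i 1) : Matrix (Fin k) (Fin k) ℝ).trace = 1
      rw [Matrix.trace_vecMulVec]; simp
    · simp [LinearMap.sum_apply, vecMulVec_apply, Pi.single_apply]
  · rintro _ ⟨X, ⟨hX, hXL⟩, rfl⟩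
    have htr : X.trace = 1 := hXL
    have := (convex_convexHull ℝ (Set.range p)).sum_mem (t := Finset.univ) (w := fun i => X i i)
      (z := p) (fun i _ => psd_diag_nonneg hX i) htr
      (fun i _ => subset_convexHull ℝ _ ⟨i, rfl⟩)
    simpa [LinearMap.sum_apply] using this

open Matrix in
/-- Four points whose homogenizations satisfy a linear relation with the signs of crossing
diagonals span a polygon with a lift of size three. -/
theorem hasPsdLift_three_of_diagonals {n : ℕ} {p₁ p₂ p₃ p₄ : Rn n} {l₁ l₂ l₃ l₄ : ℝ}
    (h₁ : 0 < l₁) (h₂ : 0 < l₂) (h₃ : 0 < l₃) (h₄ : 0 < l₄) (hl : l₁ + l₃ = l₂ + l₄)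
    (hp : l₁ • p₁ + l₃ • p₃ = l₂ • p₂ + l₄ • p₄) :
    HasPsdLift 3 (convexHull ℝ ({p₁, p₂, p₃, p₄} : Set (Rn n))) := by
  let e : Fin 3 → Fin 3 → Matrix (Fin 3) (Fin 3) ℝ →ₗ[ℝ] ℝ := Matrix.entryLinearMap ℝ ℝ
  let g : Matrix (Fin 3) (Fin 3) ℝ →ₗ[ℝ] ℝ × ℝ × ℝ :=
    (e 0 1 - e 1 1).prod ((e 0 2 - e 2 2).prod
      (l₁ • e 0 0 + (l₂ - l₁) • e 0 1 + (l₄ - l₁) • e 0 2))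
  let π : Matrix (Fin 3) (Fin 3) ℝ →ₗ[ℝ] Rn n :=
    (e 0 0).smulRight (l₁ • p₁) + (e 0 1).smulRight (l₂ • p₂ - l₁ • p₁) +
      (e 0 2).smulRight (l₄ • p₄ - l₁ • p₁)
  have hπ : ∀ X, π X = X 0 0 • (l₁ • p₁) + X 0 1 • (l₂ • p₂ - l₁ • p₁) +
      X 0 2 • (l₄ • p₄ - l₁ • p₁) := fun X => rfl
  have hmem : ∀ X, X ∈ levelSubspace g (0, 0, 1) ↔ X 0 1 = X 1 1 ∧ X 0 2 = X 2 2 ∧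
      l₁ * X 0 0 + (l₂ - l₁) * X 0 1 + (l₄ - l₁) * X 0 2 = 1 := by
    intro X
    rw [mem_levelSubspace]
    simp [g, e, Prod.ext_iff, sub_eq_zero]
  have hp3 : l₃ • p₃ = l₂ • p₂ + l₄ • p₄ - l₁ • p₁ := by rw [← hp]; abel
  refine ⟨levelSubspace g (0, 0, 1), π, subset_antisymm ?_ ?_⟩
  -- The corners `(x, y)` of the unit square give the rank-one matrices of `(1, x, y)`, scaled by
  -- `l⁻¹` to meet the normalisation.
  · have hvert : ∀ (x y l : ℝ) (p : Rn n), x ^ 2 = x → y ^ 2 = y → 0 < l →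
        l₁ + (l₂ - l₁) * x + (l₄ - l₁) * y = l →
        l₁ • p₁ + x • (l₂ • p₂ - l₁ • p₁) + y • (l₄ • p₄ - l₁ • p₁) = l • p →
        p ∈ π '' (psdCone 3 ∩ (levelSubspace g (0, 0, 1) : Set (Matrix (Fin 3) (Fin 3) ℝ))) := by
      intro x y l p hx hy hl0 hsum hpt
      refine ⟨l⁻¹ • vecMulVec ![1, x, y] ![1, x, y],
        ⟨(psd_vecMulVec _).smul (inv_pos.mpr hl0).le, ?_⟩, ?_⟩
      · rw [SetLike.mem_coe, hmem]
        simp only [Matrix.smul_apply, vecMulVec_apply, smul_eq_mul]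
        simp only [Matrix.cons_val_zero, Matrix.cons_val_one, Matrix.cons_val, one_mul, mul_one]
        refine ⟨by rw [← sq, hx], by rw [← sq, hy], ?_⟩
        have : l⁻¹ * l = 1 := inv_mul_cancel₀ hl0.ne'
        linear_combination l⁻¹ * hsum + this
      · rw [map_smul, hπ]
        simp only [vecMulVec_apply, Matrix.cons_val_zero, Matrix.cons_val_one, Matrix.cons_val,
          one_mul, one_smul]
        rw [hpt, smul_smul, inv_mul_cancel₀ hl0.ne', one_smul]
    refine convexHull_min ?_ (convex_image_lift _ _)
    rintro p (rfl | rfl | rfl | rfl)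
    · exact hvert 0 0 l₁ _ (by norm_num) (by norm_num) h₁ (by ring) (by simp)
    · exact hvert 1 0 l₂ _ (by norm_num) (by norm_num) h₂ (by ring) (by simp)
    · exact hvert 1 1 l₃ _ (by norm_num) (by norm_num) h₃ (by linarith) (by
        rw [hp3, one_smul, one_smul]; abel)
    · exact hvert 0 1 l₄ _ (by norm_num) (by norm_num) h₄ (by ring) (by simp)
  · rintro _ ⟨X, ⟨hX, hXL⟩, rfl⟩
    rw [SetLike.mem_coe, hmem] at hXL
    obtain ⟨hx, hy, hsum⟩ := hXL
    have ha0 := psd_diag_nonneg hX 0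
    have hx0 := psd_diag_nonneg hX 1
    have hy0 := psd_diag_nonneg hX 2
    have hx1 := psd_sq_le hX 0 1
    have hy1 := psd_sq_le hX 0 2
    rw [← hx] at hx0 hx1
    rw [← hy] at hy0 hy1
    rw [hπ]
    generalize X 0 0 = a at *
    generalize X 0 1 = x at *
    generalize X 0 2 = y at *
    have ha : 0 < a := by
      rcases ha0.lt_or_eq with h | h
      · exact h
      · subst h
        rw [zero_mul] at hx1 hy1
        have hx2 : x = 0 := pow_eq_zero_iff two_ne_zero |>.mp (le_antisymm hx1 (sq_nonneg x))
        have hy2 : y = 0 := pow_eq_zero_iff two_ne_zero |>.mp (le_antisymm hy1 (sq_nonneg y))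
        rw [hx2, hy2] at hsum
        norm_num at hsum
    have hxa : 0 ≤ a - x := by
      by_contra hcon
      push Not at hcon
      nlinarith
    have hya : 0 ≤ a - y := by
      by_contra hcon
      push Not at hcon
      nlinarith
    -- `(x / a, y / a)` lies in the unit square; the weights are its bilinear coordinates times `a *
    -- lᵢ`.
    have hmemP := (convex_convexHull ℝ ({p₁, p₂, p₃, p₄} : Set (Rn n))).sum_mem
      (t := Finset.univ)
      (w := ![(a - x) * (a - y) / a * l₁, x * (a - y) / a * l₂, x * y / a * l₃,
        (a - x) * y / a * l₄])
      (z := ![p₁, p₂, p₃, p₄])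
      (by intro i _; fin_cases i <;> simp <;> positivity)
      (by
        simp only [Fin.sum_univ_four, Matrix.cons_val_zero, Matrix.cons_val_one, Matrix.cons_val]
        rw [← hsum, show l₃ = l₂ + l₄ - l₁ by linarith]
        field_simp
        ring)
      (by
        intro i _
        apply subset_convexHull
        fin_cases i <;> simp)
    simp only [Fin.sum_univ_four, Matrix.cons_val_zero, Matrix.cons_val_one, Matrix.cons_val,
      mul_smul _ l₁, mul_smul _ l₂, mul_smul _ l₃, mul_smul _ l₄, hp3] at hmemP
    convert hmemP using 1
    ext i
    simp only [PiLp.add_apply, PiLp.smul_apply, PiLp.sub_apply, smul_eq_mul]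
    field_simp
    ring

/-! ### Polygons and the classification -/

theorem exists_mem_notMem_finset {α : Type*} {V : Set α} {S : Finset α} {m : ℕ} (hS : S.card ≤ m)
    (h : (m + 1 : ℕ) ≤ V.encard) : ∃ x ∈ V, x ∉ S := by
  by_contra hcon
  push Not at hcon
  have h1 : V.encard ≤ (S : Set α).encard := Set.encard_le_encard hcon
  rw [Set.encard_coe_eq_coe_finsetCard] at h1
  have h2 := h.trans h1
  norm_cast at h2
  omega

theorem IsPolygon.isBounded {P : Set (Rn 2)} (hP : IsPolygon P) : Bornology.IsBounded P := by
  obtain ⟨⟨V, rfl⟩, -⟩ := hP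
  exact (V.finite_toSet.isCompact_convexHull ℝ).isBounded

theorem IsPolygon.convex {P : Set (Rn 2)} (hP : IsPolygon P) : Convex ℝ P := by
  obtain ⟨⟨V, rfl⟩, -⟩ := hP
  exact convex_convexHull ℝ _

theorem IsPolygon.finite_extremePoints {P : Set (Rn 2)} (hP : IsPolygon P) :
    (P.extremePoints ℝ).Finite := by
  obtain ⟨⟨V, rfl⟩, -⟩ := hP
  exact V.finite_toSet.subset extremePoints_convexHull_subset

theorem IsPolygon.eq_convexHull {P : Set (Rn 2)} (hP : IsPolygon P) :
    P = convexHull ℝ (P.extremePoints ℝ) := by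
  have hc : IsCompact P := by
    obtain ⟨⟨V, rfl⟩, -⟩ := hP
    exact V.finite_toSet.isCompact_convexHull ℝ
  have h := closure_convexHull_extremePoints hc hP.convex
  rw [(hP.finite_extremePoints.isCompact_convexHull ℝ).isClosed.closure_eq] at h
  exact h.symm

theorem IsPolygon.convexPosition {P : Set (Rn 2)} (hP : IsPolygon P) :
    ConvexPosition (P.extremePoints ℝ) := fun _ hv h =>
  (hP.convex.mem_extremePoints_iff_mem_sdiff_convexHull_sdiff.mp hv).2
    (convexHull_mono (Set.sdiff_subset_sdiff_left extremePoints_subset) h)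

theorem IsPolygon.three_le_encard {P : Set (Rn 2)} (hP : IsPolygon P) :
    ((2 + 1 : ℕ) : ℕ∞) ≤ (P.extremePoints ℝ).encard := by
  have hfin := hP.finite_extremePoints
  have hint := hP.2
  rw [hP.eq_convexHull, interior_convexHull_nonempty_iff_affineSpan_eq_top] at hint
  have := hfin.fintype
  have hne : Nonempty (P.extremePoints ℝ) := by
    rw [Set.nonempty_coe_sort, Set.nonempty_iff_ne_empty]
    intro h
    rw [h, AffineSubspace.span_empty] at hint
    exact AffineSubspace.bot_ne_top ℝ (Rn 2) (Rn 2) hint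
  have h1 := finrank_vectorSpan_range_add_one_le ℝ ((↑) : P.extremePoints ℝ → Rn 2)
  rw [Subtype.range_coe, ← direction_affineSpan, hint, AffineSubspace.direction_top, finrank_top,
    finrank_euclideanSpace_fin] at h1
  rw [Set.encard_eq_coe_toFinset_card, Set.toFinset_card]
  exact_mod_cast h1

theorem IsPolygon.exists_isNext {P : Set (Rn 2)} (hP : IsPolygon P) {v : Rn 2}
    (hv : v ∈ P.extremePoints ℝ) : ∃ w, IsNext (P.extremePoints ℝ) v w := by
  obtain ⟨x, hx, hxS⟩ := exists_mem_notMem_finset (S := {v}) (m := 2) (by simp) hP.three_le_encard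
  exact hP.convexPosition.exists_isNext hP.finite_extremePoints hv ⟨x, hx, by simpa using hxS⟩

theorem IsPolygon.exists_third {P : Set (Rn 2)} (hP : IsPolygon P) (a b : Rn 2) :
    ∃ x ∈ P.extremePoints ℝ, x ≠ a ∧ x ≠ b := by
  obtain ⟨x, hx, hxS⟩ := exists_mem_notMem_finset (S := {a, b}) Finset.card_le_two
    hP.three_le_encard
  exact ⟨x, hx, by simpa using hxS⟩

theorem IsPolygon.exists_orient_pos {P : Set (Rn 2)} (hP : IsPolygon P) {v w : Rn 2}
    (h : IsNext (P.extremePoints ℝ) v w) : ∃ r ∈ P, 0 < orient v w r := by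
  obtain ⟨x, hx, hxv, hxw⟩ := hP.exists_third v w
  exact ⟨x, extremePoints_subset hx, h.2.2 x hx hxv hxw⟩

theorem IsPolygon.nonempty_extremePoints {P : Set (Rn 2)} (hP : IsPolygon P) :
    ∃ v, v ∈ P.extremePoints ℝ := by
  obtain ⟨x, hx, -⟩ := hP.exists_third 0 0
  exact ⟨x, hx⟩

theorem IsPolygon.three_le_of_hasPsdLift {P : Set (Rn 2)} (hP : IsPolygon P) {k : ℕ}
    (h : HasPsdLift k P) : 3 ≤ k := by
  obtain ⟨v, hv⟩ := hP.nonempty_extremePoints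
  obtain ⟨w, hw⟩ := hP.exists_isNext hv
  obtain ⟨r, hr, hpos⟩ := hP.exists_orient_pos hw
  exact _root_.three_le_of_hasPsdLift hP.isBounded (hw.isEdge hP.eq_convexHull hv) hr hpos h

theorem IsPolygon.psdRank_eq_three_iff {P : Set (Rn 2)} (hP : IsPolygon P) :
    psdRank P = 3 ↔ HasPsdLift 3 P := by
  have hge : (3 : ℕ∞) ≤ psdRank P := by
    refine le_iInf fun k => le_iInf fun hk => ?_
    exact_mod_cast hP.three_le_of_hasPsdLift hk.2
  constructor
  · intro h
    have hlt : psdRank P < 4 := by rw [h]; decide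
    unfold psdRank at hlt
    simp only [iInf_lt_iff] at hlt
    obtain ⟨k, hk, hk4⟩ := hlt
    have h3 := hP.three_le_of_hasPsdLift hk.2
    have h4 : k < 4 := by exact_mod_cast hk4
    obtain rfl : k = 3 := by omega
    exact hk.2
  · intro h
    refine le_antisymm ?_ hge
    have := iInf₂_le (f := fun (k : ℕ) (_ : 0 < k ∧ HasPsdLift k P) => (k : ℕ∞)) 3
      ⟨by norm_num, h⟩
    simpa [psdRank] using this

/-- A polygon with at least four vertices has four consecutive distinct vertices. -/
theorem IsPolygon.exists_four {P : Set (Rn 2)} (hP : IsPolygon P)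
    (h4 : ((3 + 1 : ℕ) : ℕ∞) ≤ (P.extremePoints ℝ).encard) :
    ∃ a b c d, a ∈ P.extremePoints ℝ ∧ IsNext (P.extremePoints ℝ) a b ∧
      IsNext (P.extremePoints ℝ) b c ∧ IsNext (P.extremePoints ℝ) c d ∧ c ≠ a ∧ d ≠ b ∧ d ≠ a := by
  obtain ⟨a, ha⟩ := hP.nonempty_extremePoints
  obtain ⟨b, hb⟩ := hP.exists_isNext ha
  obtain ⟨c, hc⟩ := hP.exists_isNext hb.1
  obtain ⟨d, hd⟩ := hP.exists_isNext hc.1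
  obtain ⟨x, hx, hxa, hxb⟩ := hP.exists_third a b
  obtain ⟨y, hy, hyb, hyc⟩ := hP.exists_third b c
  obtain ⟨z, hz, hzS⟩ := exists_mem_notMem_finset (S := {a, b, c}) Finset.card_le_three h4
  simp only [Finset.mem_insert, Finset.mem_singleton, not_or] at hzS
  have hca := hb.ne_prev hc hx hxa hxb
  exact ⟨a, b, c, d, ha, hb, hc, hd, hca, hc.ne_prev hd hy hyb hyc,
    hb.ne_prev_prev hP.convexPosition ha hc hd hca hz hzS.1 hzS.2.1 hzS.2.2⟩

theorem IsQuadrilateral.hasPsdLift {P : Set (Rn 2)} (h : IsQuadrilateral P) : HasPsdLift 3 P := by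
  obtain ⟨hP, h4⟩ := h
  obtain ⟨a, b, c, d, ha, hb, hc, hd, hca, hdb, hda⟩ := hP.exists_four h4.ge
  have hV : P.extremePoints ℝ = {a, b, c, d} := by
    have hsub : ({a, b, c, d} : Set (Rn 2)) ⊆ P.extremePoints ℝ := by
      rintro y (rfl | rfl | rfl | rfl)
      exacts [ha, hb.1, hc.1, hd.1]
    refine (Set.Finite.eq_of_subset_of_encard_le (Set.toFinite _) hsub ?_).symm
    have hd1 : c ∉ ({d} : Set (Rn 2)) := by simpa using hd.2.1.symm
    have hd2 : b ∉ ({c, d} : Set (Rn 2)) := by simp [hc.2.1.symm, hdb.symm]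
    have hd3 : a ∉ ({b, c, d} : Set (Rn 2)) := by simp [hb.2.1.symm, hca.symm, hda.symm]
    rw [h4, Set.encard_insert_of_notMem hd3, Set.encard_insert_of_notMem hd2,
      Set.encard_insert_of_notMem hd1, Set.encard_singleton]
    norm_num
  rw [hP.eq_convexHull, hV]
  -- In the affine dependence of four points, each coefficient is, up to sign, the area of the
  -- triangle on the other three.
  have e1 := hc.2.2 d hd.1 hdb hd.2.1
  have e2 := hd.2.2 a ha hca.symm hda.symm
  have e3 := hb.2.2 d hd.1 hda hdb
  have e4 := hb.2.2 c hc.1 hca hc.2.1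
  refine hasPsdLift_three_of_diagonals e1 e2 e3 e4 (by unfold orient; ring) ?_
  ext i
  simp only [PiLp.add_apply, PiLp.smul_apply, smul_eq_mul]
  fin_cases i <;> · simp [orient]; ring

theorem IsTriangle.hasPsdLift {P : Set (Rn 2)} (h : IsTriangle P) : HasPsdLift 3 P := by
  obtain ⟨hP, h3⟩ := h
  obtain ⟨a, b, c, -, -, -, hV⟩ := Set.encard_eq_three.mp h3
  have := hasPsdLift_convexHull_range ![a, b, c]
  have hr : Set.range ![a, b, c] = {a, b, c} := by
    ext x
    simp only [Matrix.range_cons, Matrix.range_empty, Set.union_empty, Set.mem_union,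
      Set.mem_singleton_iff, Set.mem_insert_iff]
  rwa [hr, ← hV, ← hP.eq_convexHull] at this

open Matrix in
theorem IsPolygon.not_hasPsdLift_three {P : Set (Rn 2)} (hP : IsPolygon P)
    (h5 : ((4 + 1 : ℕ) : ℕ∞) ≤ (P.extremePoints ℝ).encard) : ¬ HasPsdLift 3 P := by
  rintro ⟨L, π, hL⟩
  have hh := hP.eq_convexHull
  have hb := hP.isBounded
  have hlift : ∀ p : P.extremePoints ℝ, ∃ u : Fin 3 → ℝ, vecMulVec u u ∈ L ∧
      π (vecMulVec u u) = p := by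
    rintro ⟨p, hp⟩
    obtain ⟨q, hq⟩ := hP.exists_isNext hp
    obtain ⟨r, hr, hpos⟩ := hP.exists_orient_pos hq
    exact exists_rankOne_lift hL hb (hq.isEdge hh hp) hr hpos
  choose u huL hu using hlift
  have hslack : ∀ p q : P.extremePoints ℝ, IsNext (P.extremePoints ℝ) p q →
      ∃ w : Fin 3 → ℝ, ∀ x : P.extremePoints ℝ, (u x ⬝ᵥ w) ^ 2 = orient p q x := by
    intro p q hq
    obtain ⟨r, hr, hpos⟩ := hP.exists_orient_pos hq
    obtain ⟨w, hw⟩ := exists_sqrt_slack hL hb (hq.isEdge hh p.2) hr hpos (huL p) (huL q)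
      (hu p) (hu q)
    exact ⟨w, fun x => by rw [hw _ (huL x), hu]⟩
  obtain ⟨a, b, c, d, ha, hab, hbc, hcd, hca, hdb, hda⟩ :=
    hP.exists_four (le_trans (by norm_num) h5)
  obtain ⟨e, hde⟩ := hP.exists_isNext hcd.1
  obtain ⟨y, hy, hyc, hyd⟩ := hP.exists_third c d
  have hec : e ≠ c := hcd.ne_prev hde hy hyc hyd
  obtain ⟨z, hz, hzS⟩ := exists_mem_notMem_finset (S := {a, b, c, d}) Finset.card_le_four h5
  simp only [Finset.mem_insert, Finset.mem_singleton, not_or] at hzS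
  -- This is where a fifth vertex is needed: in a quadrilateral `e = a`, and the slack of edge `d e`
  -- at `a` would vanish.
  have hea : e ≠ a := hab.ne_prev_prev_prev hP.convexPosition ha hbc hcd hde hca hda hz
    hzS.1 hzS.2.1 hzS.2.2.1 hzS.2.2.2
  let v : Fin 5 → P.extremePoints ℝ :=
    ![⟨a, ha⟩, ⟨b, hab.1⟩, ⟨c, hbc.1⟩, ⟨d, hcd.1⟩, ⟨e, hde.1⟩]
  have hnext : ∀ j : Fin 4, IsNext (P.extremePoints ℝ) (v j.castSucc) (v j.succ) := by
    intro j
    fin_cases j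
    exacts [hab, hbc, hcd, hde]
  choose w hw using fun j => hslack _ _ (hnext j)
  refine no_sqrt_slack (u := fun i => u (v i.castSucc)) (w := w) (v := fun i => v i)
    (fun i j => hw j _) ?_ ?_ ?_ ?_ ?_
  · exact (hbc.2.2 a ha hab.2.1.symm hca.symm).ne'
  · exact (hde.2.2 a ha hda.symm hea.symm).ne'
  · exact (hcd.2.2 b hab.1 hbc.2.1.symm hdb.symm).ne'
  · exact (hde.2.2 c hbc.1 hcd.2.1.symm hec.symm).ne'
  · exact (hab.2.2 d hcd.1 hda hdb).ne'

theorem proposition5p7 (P : Set (Rn 2)) (hP : IsPolygon P) :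
    IsPsdMinimal P ↔ (IsTriangle P ∨ IsQuadrilateral P) := by
  have hmin : IsPsdMinimal P ↔ HasPsdLift 3 P := by
    rw [← hP.psdRank_eq_three_iff]
    have h3 : ((2 : ℕ) : ℕ∞) + 1 = 3 := by norm_num
    unfold IsPsdMinimal
    rw [h3]
    exact and_iff_right hP
  rw [hmin]
  constructor
  · intro h
    have hlt : ¬ ((4 + 1 : ℕ) : ℕ∞) ≤ (P.extremePoints ℝ).encard :=
      fun h5 => hP.not_hasPsdLift_three h5 h
    have hge := hP.three_le_encard
    have hcard := hP.finite_extremePoints.cast_ncard_eq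
    rw [← hcard] at hlt hge
    norm_cast at hlt hge
    have : (P.extremePoints ℝ).ncard = 3 ∨ (P.extremePoints ℝ).ncard = 4 := by omega
    rcases this with h | h
    · exact Or.inl ⟨hP, by rw [← hcard, h]⟩
    · exact Or.inr ⟨hP, by rw [← hcard, h]⟩
  · rintro (h | h)
    exacts [h.hasPsdLift, h.hasPsdLift]
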